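/- Let $n,p$ be integers with $2\le p\le n-2$ and let $\beta>0$. Equip the Stiefel manifold $\mathrm{St}(n,p)=\{X\in\mathbb{R}^{n\times p}\mid X^\top X=I_p\}$ with the Riemannian metric $g$ defined as follows: for $X\in\mathrm{St}(n,p)$, $X_\perp$ such that $[X\ X_\perp]$ is orthogonal, and tangent vectors $\xi_i=XA_i+X_\perp H_i$ with $A_i\in\mathbb{R}^{p\times p}$ skew-symmetric and $H_i\in\mathbb{R}^{(n-p)\times p}$ $(i=1,2)$, \[ g_X(\xi_1,\xi_2)=\beta\,\mathrm{trace}(A_1^\top A_2)+\mathrm{trace}(H_1^\top H_2). \] Let $d$ be the induced Riemannian distance and let \[ \mathrm{inj}_{\mathrm{St}_\beta(n,p)}=\inf_{X,\;\xi}\ \sup\{t>0\mid d(X,\gamma_\xi(t))=t\} \] be the injectivity radius of this Riemannian manifold, where $X$ runs over $\mathrm{St}(n,p)$, $\xi$ over the $g$-unit tangent vectors at $X$, and $\gamma_\xi$ is the geodesic with $\gamma_\xi(0)=X$, $\gamma_\xi'(0)=\xi$. Then the equation $\frac{\sin t}{t}+\frac{1-\beta}{\beta}\cos t=0$ has a smallest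 positive solution $t^{\mathrm r}_\beta$, and \[ \mathrm{inj}_{\mathrm{St}_\beta(n,p)}\le\min\{\sqrt{2\beta}\,\pi,\ \pi,\ t^{\mathrm r}_\beta\sqrt2\}. \] -/

import Mathlib

/-! The Stiefel manifold with the one-parameter family of metrics of Hüper, Markina and
Silva Leite, and the injectivity radius of the resulting complete Riemannian manifold. -/

namespace StiefelInj

noncomputable section

open scoped ENNReal ContDiff

attribute [local instance] Matrix.frobeniusNormedAddCommGroup Matrix.frobeniusNormedSpace

/-- The Stiefel manifold `St(n,p)` of orthonormal `p`-frames in `ℝⁿ`, a closed embedded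
submanifold of `ℝ^{n×p}`. -/
def stiefel (n p : ℕ) : Set (Matrix (Fin n) (Fin p) ℝ) :=
  {X | X.transpose * X = 1}

/-- The tangent space of the Stiefel manifold at `X`. -/
def tangentSpace {n p : ℕ} (X : Matrix (Fin n) (Fin p) ℝ) :
    Set (Matrix (Fin n) (Fin p) ℝ) :=
  {ξ | X.transpose * ξ + ξ.transpose * X = 0}

/-- The metric `g_β`: writing `ξ = X A + X_⊥ H` and `η = X B + X_⊥ K` with `[X X_⊥]` orthogonal,
`g_β(ξ, η) = β tr(Aᵀ B) + tr(Hᵀ K)`. Here `A = Xᵀ ξ` and `X_⊥ X_⊥ᵀ = 1 - X Xᵀ`;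
see `metric_eq`. -/
def metric {n p : ℕ} (β : ℝ) (X ξ η : Matrix (Fin n) (Fin p) ℝ) : ℝ :=
  β * ((X.transpose * ξ).transpose * (X.transpose * η)).trace
    + (ξ.transpose * (1 - X * X.transpose) * η).trace

theorem metric_eq {n p q : ℕ} (β : ℝ) (X : Matrix (Fin n) (Fin p) ℝ)
    (Xp : Matrix (Fin n) (Fin q) ℝ) (hX : X.transpose * X = 1)
    (hXp : Xp.transpose * Xp = 1) (hperp : X.transpose * Xp = 0)
    (A B : Matrix (Fin p) (Fin p) ℝ) (H K : Matrix (Fin q) (Fin p) ℝ) :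
    metric β X (X * A + Xp * H) (X * B + Xp * K)
      = β * (A.transpose * B).trace + (H.transpose * K).trace := by
  have e (C : Matrix (Fin p) (Fin p) ℝ) (L : Matrix (Fin q) (Fin p) ℝ) :
      X.transpose * (X * C + Xp * L) = C := by
    rw [Matrix.mul_add, ← Matrix.mul_assoc, ← Matrix.mul_assoc, hX, hperp]; simp
  have f : (1 - X * X.transpose) * (X * B + Xp * K) = Xp * K := by
    rw [Matrix.sub_mul, Matrix.mul_assoc, e]; simp
  have hperp' : Xp.transpose * X = 0 := by
    have := congrArg Matrix.transpose hperp
    simpa [Matrix.transpose_mul] using this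
  have k : (X * A + Xp * H).transpose * (Xp * K) = H.transpose * K := by
    rw [Matrix.transpose_add, Matrix.transpose_mul, Matrix.transpose_mul, Matrix.add_mul,
      Matrix.mul_assoc, Matrix.mul_assoc, ← Matrix.mul_assoc X.transpose, hperp,
      ← Matrix.mul_assoc Xp.transpose, hXp]
    simp
  rw [metric, e, e, Matrix.mul_assoc, f, k]

/-- The unit tangent space at `X`. -/
def unitTangent {n p : ℕ} (β : ℝ) (X : Matrix (Fin n) (Fin p) ℝ) :
    Set (Matrix (Fin n) (Fin p) ℝ) :=
  {ξ | ξ ∈ tangentSpace X ∧ metric β X ξ ξ = 1}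

/-- The length of a curve over `[a, b]`. -/
def curveLength {n p : ℕ} (β : ℝ) (γ : ℝ → Matrix (Fin n) (Fin p) ℝ) (a b : ℝ) : ℝ :=
  ∫ t in a..b, Real.sqrt (metric β (γ t) (deriv γ t) (deriv γ t))

/-- The energy of a curve over `[a, b]`. -/
def curveEnergy {n p : ℕ} (β : ℝ) (γ : ℝ → Matrix (Fin n) (Fin p) ℝ) (a b : ℝ) : ℝ :=
  (1 / 2) * ∫ t in a..b, metric β (γ t) (deriv γ t) (deriv γ t)

/-- `γ` restricted to `[a, b]` is a piecewise `C¹` curve in the Stiefel manifold: there is a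
finite partition `a = τ 0 ≤ ⋯ ≤ τ N = b` such that `γ` is `C¹` on each closed piece. -/
def IsPiecewiseC1 {n p : ℕ} (γ : ℝ → Matrix (Fin n) (Fin p) ℝ) (a b : ℝ) : Prop :=
  (∀ t ∈ Set.Icc a b, γ t ∈ stiefel n p) ∧
    ∃ (N : ℕ) (τ : ℕ → ℝ), Monotone τ ∧ τ 0 = a ∧ τ N = b ∧
      ∀ k < N, ContDiffOn ℝ 1 γ (Set.Icc (τ k) (τ (k + 1)))

/-- The Riemannian distance of `g_β`: the infimum of the lengths of the piecewise `C¹` curves in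
the Stiefel manifold from `X` to `Y`. -/
def stiefelDist {n p : ℕ} (β : ℝ) (X Y : Matrix (Fin n) (Fin p) ℝ) : ℝ≥0∞ :=
  sInf {L | ∃ (γ : ℝ → Matrix (Fin n) (Fin p) ℝ) (a b : ℝ), a ≤ b ∧ IsPiecewiseC1 γ a b ∧
    γ a = X ∧ γ b = Y ∧ L = ENNReal.ofReal (curveLength β γ a b)}

/-- `Γ s t` is a smooth variation of the curve `γ` in the Stiefel manifold, with variation
parameter `s`, that keeps the endpoints at `t = a` and `t = b` fixed. -/
structure IsProperVariation {n p : ℕ} (γ : ℝ → Matrix (Fin n) (Fin p) ℝ) (a b : ℝ)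
    (Γ : ℝ → ℝ → Matrix (Fin n) (Fin p) ℝ) : Prop where
  smooth : ContDiff ℝ ∞ (fun z : ℝ × ℝ => Γ z.1 z.2)
  mem : ∀ s t, Γ s t ∈ stiefel n p
  base : ∀ t, Γ 0 t = γ t
  left : ∀ s, Γ s a = γ a
  right : ∀ s, Γ s b = γ b

/-- `γ : ℝ → St(n,p)` is a geodesic of `g_β`: a smooth curve that, on every compact interval, is
a critical point of the energy under variations with fixed endpoints. (The manifold is compact,
hence complete, so that every geodesic extends to all of `ℝ`.) -/
structure IsGeodesic {n p : ℕ} (β : ℝ) (γ : ℝ → Matrix (Fin n) (Fin p) ℝ) : Prop where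
  smooth : ContDiff ℝ ∞ γ
  mem : ∀ t, γ t ∈ stiefel n p
  critical : ∀ a b : ℝ, a < b → ∀ Γ : ℝ → ℝ → Matrix (Fin n) (Fin p) ℝ,
    IsProperVariation γ a b Γ → HasDerivAt (fun s => curveEnergy β (Γ s) a b) 0 0

/-- The cut time `sup {t > 0 | d(γ(0), γ(t)) = t}` of a unit-speed geodesic `γ`. -/
def cutTime {n p : ℕ} (β : ℝ) (γ : ℝ → Matrix (Fin n) (Fin p) ℝ) : ℝ≥0∞ :=
  sSup {r | ∃ t : ℝ, 0 < t ∧ stiefelDist β (γ 0) (γ t) = ENNReal.ofReal t ∧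
    r = ENNReal.ofReal t}

/-- The injectivity radius at `X`: the infimum, over the unit tangent vectors `ξ` at `X`, of the
cut time of the geodesic `γ` with `γ(0) = X` and `γ'(0) = ξ`. -/
def injRadiusAt {n p : ℕ} (β : ℝ) (X : Matrix (Fin n) (Fin p) ℝ) : ℝ≥0∞ :=
  sInf {r | ∃ ξ ∈ unitTangent β X, ∃ γ : ℝ → Matrix (Fin n) (Fin p) ℝ,
    IsGeodesic β γ ∧ γ 0 = X ∧ deriv γ 0 = ξ ∧ r = cutTime β γ}

/-- The injectivity radius of `St_β(n,p)`. -/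
def injRadius (n p : ℕ) (β : ℝ) : ℝ≥0∞ :=
  sInf {r | ∃ X ∈ stiefel n p, r = injRadiusAt β X}

end

end StiefelInj

/-!
A closed geodesic does not minimize beyond half its length. A horizontal great circle in a
one-dimensional normal direction has length `2π`, and a Hopf fibre of a Berger sphere
`S³ ⊂ St(n,p)` has length `2√(2β)π`; this gives the bounds `π` and `√(2β)π`.

For the third bound, let `β < 1` and consider a great circle of `S³` orthogonal to the Hopf fibres.
Its point of parameter `T` is also reached by other great circles of `S³` turned along the Hopf
action. For such a curve close to the original great circle, the first-order term of the difference
of the squared lengths has the sign of `sin T / T + (1 - β) / β * cos T`, which is negative for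
`t^r_β < T < π`: the new curve is shorter. At `T = π` half of the Hopf fibre is shorter. For `β ≥ 1`
the zero `t^r_β` is at least `π`, so the bound `π` suffices.
-/

namespace StiefelInj

noncomputable section

open Real Set
open scoped ENNReal ContDiff Matrix

attribute [local instance] Matrix.frobeniusNormedAddCommGroup Matrix.frobeniusNormedSpace

section MatrixCalculus

variable {l m n : Type*}

theorem isBoundedBilinearMap_matrixMul [Fintype l] [Fintype m] [Fintype n] :
    IsBoundedBilinearMap ℝ fun z : Matrix l m ℝ × Matrix m n ℝ => z.1 * z.2 :=
  (mulLinearMap ℝ : Matrix l m ℝ →ₗ[ℝ] Matrix m n ℝ →ₗ[ℝ]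
    Matrix l n ℝ).toContinuousBilinearMap.isBoundedBilinearMap

theorem isBoundedLinearMap_transpose [Fintype m] [Fintype n] :
    IsBoundedLinearMap ℝ (Matrix.transpose : Matrix m n ℝ → Matrix n m ℝ) :=
  (Matrix.transposeLinearEquiv m n ℝ ℝ).toLinearMap.toContinuousLinearMap.isBoundedLinearMap

theorem isBoundedLinearMap_trace [Fintype n] :
    IsBoundedLinearMap ℝ (Matrix.trace : Matrix n n ℝ → ℝ) :=
  (Matrix.traceLinearMap n ℝ ℝ).toContinuousLinearMap.isBoundedLinearMap

theorem hasDerivAt_matrixMul [Finite l] [Fintype m] [Finite n] {f : ℝ → Matrix l m ℝ}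
    {g : ℝ → Matrix m n ℝ} {f' : Matrix l m ℝ} {g' : Matrix m n ℝ} {t : ℝ}
    (hf : HasDerivAt f f' t) (hg : HasDerivAt g g' t) :
    HasDerivAt (fun s => f s * g s) (f t * g' + f' * g t) t := by
  cases nonempty_fintype l
  cases nonempty_fintype n
  have hmul := isBoundedBilinearMap_matrixMul.hasFDerivAt (f t, g t)
  exact hmul.comp_hasDerivAt t (hf.prodMk hg)

theorem hasDerivAt_transpose [Finite m] [Finite n] {f : ℝ → Matrix m n ℝ} {f' : Matrix m n ℝ}
    {t : ℝ} (hf : HasDerivAt f f' t) : HasDerivAt (fun s => (f s)ᵀ) f'ᵀ t := by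
  cases nonempty_fintype m
  cases nonempty_fintype n
  exact isBoundedLinearMap_transpose.hasFDerivAt.comp_hasDerivAt t hf

variable [Fintype l] [Fintype m] [Fintype n]

theorem hasDerivAt_trace {f : ℝ → Matrix n n ℝ} {f' : Matrix n n ℝ} {t : ℝ}
    (hf : HasDerivAt f f' t) : HasDerivAt (fun s => (f s).trace) f'.trace t :=
  isBoundedLinearMap_trace.hasFDerivAt.comp_hasDerivAt t hf

theorem hasDerivAt_trace_transpose_mul {f g : ℝ → Matrix m n ℝ} {f' g' : Matrix m n ℝ} {t : ℝ}
    (hf : HasDerivAt f f' t) (hg : HasDerivAt g g' t) :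
    HasDerivAt (fun s => ((f s)ᵀ * g s).trace) (((f t)ᵀ * g').trace + (f'ᵀ * g t).trace) t :=
  (hasDerivAt_trace (hasDerivAt_matrixMul (hasDerivAt_transpose hf) hg)).congr_deriv
    (Matrix.trace_add _ _)

variable {E : Type*} [NormedAddCommGroup E] [NormedSpace ℝ E] {k : ℕ∞ω}

theorem contDiff_matrixMul {f : E → Matrix l m ℝ} {g : E → Matrix m n ℝ} (hf : ContDiff ℝ k f)
    (hg : ContDiff ℝ k g) : ContDiff ℝ k fun x => f x * g x :=
  isBoundedBilinearMap_matrixMul.contDiff.comp (hf.prodMk hg)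

theorem contDiff_transpose {f : E → Matrix m n ℝ} (hf : ContDiff ℝ k f) :
    ContDiff ℝ k fun x => (f x)ᵀ :=
  isBoundedLinearMap_transpose.contDiff.comp hf

theorem contDiff_trace_transpose_mul {f g : E → Matrix m n ℝ} (hf : ContDiff ℝ k f)
    (hg : ContDiff ℝ k g) : ContDiff ℝ k fun x => ((f x)ᵀ * g x).trace :=
  isBoundedLinearMap_trace.contDiff.comp (contDiff_matrixMul (contDiff_transpose hf) hg)

end MatrixCalculus

section Variations

variable {E : Type*} [NormedAddCommGroup E] [NormedSpace ℝ E]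

theorem hasDerivAt_comp_prodMk_left {G : ℝ × ℝ → E} {s t : ℝ}
    (hG : DifferentiableAt ℝ G (s, t)) :
    HasDerivAt (fun s => G (s, t)) (fderiv ℝ G (s, t) (1, 0)) s :=
  hG.hasFDerivAt.comp_hasDerivAt s ((hasDerivAt_id s).prodMk (hasDerivAt_const s t))

theorem hasDerivAt_comp_prodMk_right {G : ℝ × ℝ → E} {s t : ℝ}
    (hG : DifferentiableAt ℝ G (s, t)) :
    HasDerivAt (fun t => G (s, t)) (fderiv ℝ G (s, t) (0, 1)) t :=
  hG.hasFDerivAt.comp_hasDerivAt t ((hasDerivAt_const t s).prodMk (hasDerivAt_id t))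

theorem contDiff_uncurry_deriv {Γ : ℝ → ℝ → E}
    (hΓ : ContDiff ℝ ∞ fun z : ℝ × ℝ => Γ z.1 z.2) :
    ContDiff ℝ ∞ fun z : ℝ × ℝ => deriv (Γ z.1) z.2 := by
  have h (z : ℝ × ℝ) : deriv (Γ z.1) z.2 = fderiv ℝ (fun z : ℝ × ℝ => Γ z.1 z.2) z (0, 1) :=
    (hasDerivAt_comp_prodMk_right (hΓ.differentiable (by simp) z)).deriv
  simp only [h]
  exact (hΓ.fderiv_right (by simp)).clm_apply contDiff_const

theorem exists_hasDerivAt_deriv_comm {Γ : ℝ → ℝ → E}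
    (hΓ : ContDiff ℝ 2 fun z : ℝ × ℝ => Γ z.1 z.2) (s t : ℝ) :
    ∃ W, HasDerivAt (fun t => deriv (fun s => Γ s t) s) W t ∧
      HasDerivAt (fun s => deriv (Γ s) t) W s := by
  set G : ℝ × ℝ → E := fun z => Γ z.1 z.2
  have hdiff := hΓ.differentiable two_ne_zero
  have hdiff' (v : ℝ × ℝ) (z : ℝ × ℝ) : DifferentiableAt ℝ (fun z => fderiv ℝ G z v) z :=
    (((hΓ.fderiv_right (m := 1) (by norm_num)).differentiable one_ne_zero) z).clm_apply
      (differentiableAt_const v)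
  have hs (s t : ℝ) : deriv (fun s => Γ s t) s = fderiv ℝ G (s, t) (1, 0) :=
    (hasDerivAt_comp_prodMk_left (hdiff (s, t))).deriv
  have ht (s t : ℝ) : deriv (Γ s) t = fderiv ℝ G (s, t) (0, 1) :=
    (hasDerivAt_comp_prodMk_right (hdiff (s, t))).deriv
  have hfd (v w : ℝ × ℝ) : fderiv ℝ (fun z => fderiv ℝ G z v) (s, t) w
      = fderiv ℝ (fderiv ℝ G) (s, t) w v := by
    rw [fderiv_clm_apply (((hΓ.fderiv_right (m := 1) (by norm_num)).differentiable
      one_ne_zero) _) (differentiableAt_const v)]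
    simp
  have hsymm : fderiv ℝ (fderiv ℝ G) (s, t) (1, 0) (0, 1)
      = fderiv ℝ (fderiv ℝ G) (s, t) (0, 1) (1, 0) :=
    hΓ.contDiffAt.isSymmSndFDerivAt (by simp) _ _
  simp only [hs, ht]
  refine ⟨_, hasDerivAt_comp_prodMk_right (hdiff' (1, 0) (s, t)), ?_⟩
  rw [hfd, ← hsymm, ← hfd]
  exact hasDerivAt_comp_prodMk_left (hdiff' (0, 1) (s, t))

theorem continuous_deriv_comp_prodMk_left {F : ℝ → ℝ → E}
    (hF : ContDiff ℝ 1 fun z : ℝ × ℝ => F z.1 z.2) (s : ℝ) :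
    Continuous fun t => deriv (fun s => F s t) s := by
  have h (t : ℝ) : deriv (fun s => F s t) s = fderiv ℝ (fun z : ℝ × ℝ => F z.1 z.2) (s, t) (1, 0) :=
    (hasDerivAt_comp_prodMk_left (hF.differentiable one_ne_zero (s, t))).deriv
  simp only [h]
  exact ((hF.continuous_fderiv one_ne_zero).comp (Continuous.prodMk_right s)).clm_apply
    continuous_const

theorem hasDerivAt_integral_of_contDiff {F : ℝ → ℝ → E}
    (hF : ContDiff ℝ 1 fun z : ℝ × ℝ => F z.1 z.2) (a b s₀ : ℝ) :
    HasDerivAt (fun s => ∫ t in a..b, F s t)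
      (∫ t in a..b, deriv (fun s => F s t) s₀) s₀ := by
  have hder (s t : ℝ) : HasDerivAt (fun s => F s t)
      (fderiv ℝ (fun z : ℝ × ℝ => F z.1 z.2) (s, t) (1, 0)) s :=
    hasDerivAt_comp_prodMk_left (hF.differentiable one_ne_zero (s, t))
  have hc : Continuous fun z : ℝ × ℝ => fderiv ℝ (fun z : ℝ × ℝ => F z.1 z.2) z (1, 0) :=
    (hF.continuous_fderiv one_ne_zero).clm_apply continuous_const
  have hcompact := (isCompact_closedBall s₀ 1).prod (isCompact_uIcc (a := a) (b := b))
  obtain ⟨C, hC⟩ := hcompact.exists_bound_of_continuousOn hc.continuousOn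
  have hF' (s : ℝ) : Continuous (F s) := hF.continuous.comp (Continuous.prodMk_right s)
  simp only [fun t => (hder s₀ t).deriv]
  exact (intervalIntegral.hasDerivAt_integral_of_dominated_loc_of_deriv_le (bound := fun _ => C)
    (Metric.closedBall_mem_nhds s₀ one_pos)
    (.of_forall fun s => (hF' s).aestronglyMeasurable) ((hF' s₀).intervalIntegrable _ _)
    (hc.comp (Continuous.prodMk_right s₀)).aestronglyMeasurable
    (.of_forall fun t ht s hs => hC (s, t) ⟨hs, uIoc_subset_uIcc ht⟩)
    intervalIntegrable_const (.of_forall fun t _ s _ => hder s t)).2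

end Variations

section Geodesics

variable {n p : ℕ} {β : ℝ}

theorem metric_eq_trace_add (β : ℝ) (X ξ η : Matrix (Fin n) (Fin p) ℝ) :
    metric β X ξ η = (ξᵀ * η).trace + (β - 1) * ((Xᵀ * ξ)ᵀ * (Xᵀ * η)).trace := by
  have h : ξᵀ * (1 - X * Xᵀ) * η = ξᵀ * η - (Xᵀ * ξ)ᵀ * (Xᵀ * η) := by
    simp only [Matrix.mul_sub, Matrix.sub_mul, Matrix.transpose_mul, Matrix.transpose_transpose,
      Matrix.mul_assoc, Matrix.mul_one]
  rw [metric, h, Matrix.trace_sub]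
  ring

theorem metric_smul_smul (β c : ℝ) (X ξ : Matrix (Fin n) (Fin p) ℝ) :
    metric β X (c • ξ) (c • ξ) = c ^ 2 * metric β X ξ ξ := by
  simp only [metric, Matrix.transpose_smul, Matrix.mul_smul, Matrix.smul_mul, Matrix.trace_smul,
    smul_eq_mul]
  ring

theorem contDiff_metric {E : Type*} [NormedAddCommGroup E] [NormedSpace ℝ E] {k : ℕ∞ω}
    {f g h : E → Matrix (Fin n) (Fin p) ℝ} (hf : ContDiff ℝ k f) (hg : ContDiff ℝ k g)
    (hh : ContDiff ℝ k h) : ContDiff ℝ k fun x => metric β (f x) (g x) (h x) := by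
  have hfT := contDiff_transpose hf
  simp only [metric_eq_trace_add]
  exact (contDiff_trace_transpose_mul hg hh).add (contDiff_const.mul
    (contDiff_trace_transpose_mul (contDiff_matrixMul hfT hg) (contDiff_matrixMul hfT hh)))

/-- The momentum of a velocity `ξ` at `X`: the trace-gradient in `ξ` of the kinetic energy
`½ g_X(ξ, ξ)`, extended to all `n × p` matrices `X`. -/
def momentum (β : ℝ) (X ξ : Matrix (Fin n) (Fin p) ℝ) : Matrix (Fin n) (Fin p) ℝ :=
  ξ + (β - 1) • (X * (Xᵀ * ξ))

/-- The inertial force of a velocity `ξ` at `X`: the trace-gradient in `X` of the kinetic energy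
`½ g_X(ξ, ξ)`, extended to all `n × p` matrices `X`. -/
def inertialForce (β : ℝ) (X ξ : Matrix (Fin n) (Fin p) ℝ) : Matrix (Fin n) (Fin p) ℝ :=
  (β - 1) • (ξ * (ξᵀ * X))

theorem hasDerivAt_metric_self {X ξ : ℝ → Matrix (Fin n) (Fin p) ℝ}
    {V W : Matrix (Fin n) (Fin p) ℝ} {s : ℝ} (hX : HasDerivAt X V s) (hξ : HasDerivAt ξ W s) :
    HasDerivAt (fun s => metric β (X s) (ξ s) (ξ s))
      (2 * (((momentum β (X s) (ξ s))ᵀ * W).trace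
        + ((inertialForce β (X s) (ξ s))ᵀ * V).trace)) s := by
  have trace_comm {k l : ℕ} (B C : Matrix (Fin k) (Fin l) ℝ) :
      (Bᵀ * C).trace = (Cᵀ * B).trace := by
    rw [← Matrix.trace_transpose (Bᵀ * C), Matrix.transpose_mul, Matrix.transpose_transpose]
  have hXξ := hasDerivAt_matrixMul (hasDerivAt_transpose hX) hξ
  have h := (hasDerivAt_trace_transpose_mul hξ hξ).add
    ((hasDerivAt_trace_transpose_mul hXξ hXξ).const_mul (β - 1))
  simp only [metric_eq_trace_add]
  refine h.congr_deriv ?_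
  have hV : ((ξ s * ((ξ s)ᵀ * X s))ᵀ * V).trace = (((X s)ᵀ * ξ s)ᵀ * (Vᵀ * ξ s)).trace := by
    rw [trace_comm, ← Matrix.mul_assoc, Matrix.trace_mul_comm, Matrix.transpose_mul,
      Matrix.transpose_transpose]
  rw [trace_comm W, trace_comm (_ + _)]
  simp only [momentum, inertialForce, Matrix.transpose_add, Matrix.transpose_smul, Matrix.add_mul,
    Matrix.mul_add, Matrix.smul_mul, Matrix.trace_add, Matrix.trace_smul, smul_eq_mul, hV]
  simp only [Matrix.transpose_mul, Matrix.transpose_transpose, Matrix.mul_assoc]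
  ring

theorem mem_tangentSpace_of_hasDerivAt {γ : ℝ → Matrix (Fin n) (Fin p) ℝ}
    {V : Matrix (Fin n) (Fin p) ℝ} {s : ℝ} (hγ : ∀ s, γ s ∈ stiefel n p)
    (hV : HasDerivAt γ V s) : V ∈ tangentSpace (γ s) := by
  have h := hasDerivAt_matrixMul (hasDerivAt_transpose hV) hV
  have hconst : (fun s => (γ s)ᵀ * γ s) = fun _ => 1 := funext hγ
  rw [hconst] at h
  exact h.unique (hasDerivAt_const s _)

theorem trace_mul_symm_transpose_mul_eq_zero {X V : Matrix (Fin n) (Fin p) ℝ}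
    {S : Matrix (Fin p) (Fin p) ℝ} (hS : S.IsSymm) (hV : V ∈ tangentSpace X) :
    ((X * S)ᵀ * V).trace = 0 := by
  have hskew : Vᵀ * X = -(Xᵀ * V) := eq_neg_of_add_eq_zero_right hV
  have h : ((X * S)ᵀ * V).trace = -((X * S)ᵀ * V).trace := by
    conv_lhs => rw [← Matrix.trace_transpose, Matrix.transpose_mul, Matrix.transpose_transpose,
      ← Matrix.mul_assoc, hskew, Matrix.trace_mul_comm, Matrix.mul_neg, Matrix.trace_neg]
    rw [Matrix.transpose_mul, hS.eq, Matrix.mul_assoc]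
  linarith

/-- The variation field of `Γ` along its base curve `Γ 0`. -/
def variationField (Γ : ℝ → ℝ → Matrix (Fin n) (Fin p) ℝ) (t : ℝ) : Matrix (Fin n) (Fin p) ℝ :=
  deriv (fun s => Γ s t) 0

namespace IsProperVariation

variable {γ : ℝ → Matrix (Fin n) (Fin p) ℝ} {a b : ℝ} {Γ : ℝ → ℝ → Matrix (Fin n) (Fin p) ℝ}

theorem variationField_left (hΓ : IsProperVariation γ a b Γ) : variationField Γ a = 0 := by
  simp only [variationField, hΓ.left]
  exact deriv_const 0 (γ a)

theorem variationField_right (hΓ : IsProperVariation γ a b Γ) : variationField Γ b = 0 := by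
  simp only [variationField, hΓ.right]
  exact deriv_const 0 (γ b)

theorem hasDerivAt_variationField (hΓ : IsProperVariation γ a b Γ) (t : ℝ) :
    HasDerivAt (fun s => Γ s t) (variationField Γ t) 0 :=
  ((hΓ.smooth.differentiable (by simp)).comp
    (differentiable_id.prodMk (differentiable_const t)) 0).hasDerivAt

theorem variationField_mem_tangentSpace (hΓ : IsProperVariation γ a b Γ) (t : ℝ) :
    variationField Γ t ∈ tangentSpace (γ t) := by
  rw [← hΓ.base t]
  exact mem_tangentSpace_of_hasDerivAt (γ := fun s => Γ s t) (hΓ.mem · t)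
    (hΓ.hasDerivAt_variationField t)

end IsProperVariation

/-- The Euler–Lagrange equation of the energy: the symmetric multiplier `S` accounts for the
constraint `γᵀ γ = 1`. -/
theorem isGeodesic_of_hasDerivAt_momentum {γ γ' : ℝ → Matrix (Fin n) (Fin p) ℝ}
    {S : ℝ → Matrix (Fin p) (Fin p) ℝ} (hγ : ContDiff ℝ ∞ γ) (hmem : ∀ t, γ t ∈ stiefel n p)
    (hγ' : ∀ t, HasDerivAt γ (γ' t) t) (hS : ∀ t, (S t).IsSymm)
    (hEL : ∀ t, HasDerivAt (fun t => momentum β (γ t) (γ' t))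
      (γ t * S t + inertialForce β (γ t) (γ' t)) t) :
    IsGeodesic β γ := by
  refine ⟨hγ, hmem, fun a b _ Γ hΓ => ?_⟩
  obtain rfl : Γ 0 = γ := funext hΓ.base
  let F : ℝ → ℝ → ℝ := fun s t => metric β (Γ s t) (deriv (Γ s) t) (deriv (Γ s) t)
  have hF : ContDiff ℝ 1 fun z : ℝ × ℝ => F z.1 z.2 :=
    (contDiff_metric hΓ.smooth (contDiff_uncurry_deriv hΓ.smooth)
      (contDiff_uncurry_deriv hΓ.smooth)).of_le (by simp)
  have hfirst (t : ℝ) :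
      HasDerivAt (fun t => 2 * ((momentum β (Γ 0 t) (γ' t))ᵀ * variationField Γ t).trace)
        (deriv (fun s => F s t) 0) t := by
    obtain ⟨W, hWt, hWs⟩ := exists_hasDerivAt_deriv_comm
      (hΓ.smooth.of_le (WithTop.coe_le_coe.2 (le_top : (2 : ℕ∞) ≤ ⊤))) 0 t
    have hspeed : HasDerivAt (fun s => F s t)
        (2 * (((momentum β (Γ 0 t) (deriv (Γ 0) t))ᵀ * W).trace
          + ((inertialForce β (Γ 0 t) (deriv (Γ 0) t))ᵀ * variationField Γ t).trace)) 0 :=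
      hasDerivAt_metric_self (hΓ.hasDerivAt_variationField t) hWs
    have hpair : HasDerivAt (fun t => ((momentum β (Γ 0 t) (γ' t))ᵀ * variationField Γ t).trace)
        (((momentum β (Γ 0 t) (γ' t))ᵀ * W).trace
          + ((Γ 0 t * S t + inertialForce β (Γ 0 t) (γ' t))ᵀ * variationField Γ t).trace) t :=
      hasDerivAt_trace_transpose_mul (hEL t) hWt
    rw [hspeed.deriv, show deriv (Γ 0) t = γ' t from (hγ' t).deriv]
    refine (hpair.const_mul 2).congr_deriv ?_
    rw [Matrix.transpose_add, Matrix.add_mul, Matrix.trace_add,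
      trace_mul_symm_transpose_mul_eq_zero (hS t) (hΓ.variationField_mem_tangentSpace t), zero_add]
  have hint := intervalIntegral.integral_eq_sub_of_hasDerivAt (a := a) (b := b)
    (fun t _ => hfirst t)
    ((continuous_deriv_comp_prodMk_left (F := F) hF 0).intervalIntegrable a b)
  have henergy := (hasDerivAt_integral_of_contDiff (F := F) hF a b 0).const_mul (1 / 2)
  rw [hint, hΓ.variationField_left, hΓ.variationField_right, Matrix.mul_zero, Matrix.mul_zero,
    sub_self, mul_zero] at henergy
  exact henergy

theorem isGeodesic_of_horizontal {γ γ' : ℝ → Matrix (Fin n) (Fin p) ℝ}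
    {S : ℝ → Matrix (Fin p) (Fin p) ℝ} (hγ : ContDiff ℝ ∞ γ) (hmem : ∀ t, γ t ∈ stiefel n p)
    (hγ' : ∀ t, HasDerivAt γ (γ' t) t) (hhor : ∀ t, (γ t)ᵀ * γ' t = 0) (hS : ∀ t, (S t).IsSymm)
    (hacc : ∀ t, HasDerivAt γ' (γ t * S t) t) : IsGeodesic β γ := by
  refine isGeodesic_of_hasDerivAt_momentum hγ hmem hγ' hS fun t => ?_
  have hhor' : (γ' t)ᵀ * γ t = 0 := by simpa using congrArg Matrix.transpose (hhor t)
  simpa only [momentum, inertialForce, hhor, hhor', Matrix.mul_zero, smul_zero, add_zero]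
    using hacc t

theorem isGeodesic_of_vertical {γ : ℝ → Matrix (Fin n) (Fin p) ℝ} {J : Matrix (Fin p) (Fin p) ℝ}
    (hγ : ContDiff ℝ ∞ γ) (hmem : ∀ t, γ t ∈ stiefel n p)
    (hγ' : ∀ t, HasDerivAt γ (γ t * J) t) : IsGeodesic β γ := by
  have hcancel {q : ℕ} (t : ℝ) (B : Matrix (Fin p) (Fin q) ℝ) : (γ t)ᵀ * (γ t * B) = B := by
    rw [← Matrix.mul_assoc, show (γ t)ᵀ * γ t = 1 from hmem t, Matrix.one_mul]
  have hJ : Jᵀ = -J := by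
    have h : (γ 0)ᵀ * (γ 0 * J) + (γ 0 * J)ᵀ * γ 0 = 0 :=
      mem_tangentSpace_of_hasDerivAt hmem (hγ' 0)
    rw [Matrix.transpose_mul, Matrix.mul_assoc, show (γ 0)ᵀ * γ 0 = 1 from hmem 0, Matrix.mul_one,
      hcancel] at h
    exact eq_neg_of_add_eq_zero_right h
  refine isGeodesic_of_hasDerivAt_momentum (S := fun _ => (2 * β - 1) • (J * J)) hγ hmem hγ'
    (fun _ => ?_) fun t => ?_
  · simp [Matrix.IsSymm, hJ]
  · have hmom : (fun t => momentum β (γ t) (γ t * J)) = fun t => β • (γ t * J) := by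
      funext t
      rw [momentum, hcancel]
      module
    rw [hmom]
    refine ((hasDerivAt_matrixMul (hγ' t) (hasDerivAt_const t J)).const_smul β).congr_deriv ?_
    rw [inertialForce, Matrix.transpose_mul, Matrix.mul_assoc Jᵀ, show (γ t)ᵀ * γ t = 1 from hmem t,
      hJ]
    simp only [Matrix.mul_zero, Matrix.mul_one, Matrix.mul_neg, Matrix.mul_smul, Matrix.mul_assoc]
    module

end Geodesics

section InjectivityRadius

variable {n p : ℕ} {β : ℝ} {γ γ' : ℝ → Matrix (Fin n) (Fin p) ℝ}

theorem curveEnergy_comp_const_mul (β c : ℝ) (γ : ℝ → Matrix (Fin n) (Fin p) ℝ) (a b : ℝ) :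
    curveEnergy β (fun t => γ (c * t)) a b = c * curveEnergy β γ (c * a) (c * b) := by
  have hderiv (t : ℝ) : deriv (fun t => γ (c * t)) t = c • deriv γ (c * t) :=
    deriv_comp_mul_left c γ t
  simp only [curveEnergy, hderiv, metric_smul_smul, intervalIntegral.integral_const_mul]
  rw [← intervalIntegral.mul_integral_comp_mul_left
    (f := fun t => metric β (γ t) (deriv γ t) (deriv γ t))]
  ring

theorem IsGeodesic.comp_const_mul (hγ : IsGeodesic β γ) {c : ℝ} (hc : 0 < c) :
    IsGeodesic β fun t => γ (c * t) := by
  refine ⟨hγ.smooth.comp (contDiff_const.mul contDiff_id), fun t => hγ.mem _,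
    fun a b hab Γ hΓ => ?_⟩
  have hΓ' : IsProperVariation γ (c * a) (c * b) fun s t => Γ s (c⁻¹ * t) :=
    { smooth := hΓ.smooth.comp (contDiff_fst.prodMk (contDiff_const.mul contDiff_snd))
      mem := fun s t => hΓ.mem _ _
      base := fun t => by rw [hΓ.base, mul_inv_cancel_left₀ hc.ne']
      left := fun s => by rw [inv_mul_cancel_left₀ hc.ne', hΓ.left]
      right := fun s => by rw [inv_mul_cancel_left₀ hc.ne', hΓ.right] }
  have henergy (s : ℝ) : curveEnergy β (Γ s) a b
      = c * curveEnergy β (fun t => Γ s (c⁻¹ * t)) (c * a) (c * b) := by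
    rw [← curveEnergy_comp_const_mul]
    simp only [inv_mul_cancel_left₀ hc.ne']
  simp only [henergy]
  simpa only [mul_zero] using
    (hγ.critical _ _ (mul_lt_mul_of_pos_left hab hc) _ hΓ').const_mul c

theorem stiefelDist_le_of_metric_eq (hγ : ContDiff ℝ 1 γ) (hmem : ∀ t, γ t ∈ stiefel n p)
    (hγ' : ∀ t, HasDerivAt γ (γ' t) t) {v : ℝ} (hv : 0 ≤ v)
    (hspeed : ∀ t, metric β (γ t) (γ' t) (γ' t) = v ^ 2) (s : ℝ) :
    stiefelDist β (γ 0) (γ s) ≤ ENNReal.ofReal (v * |s|) := by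
  have hderiv (t : ℝ) : deriv (fun t => γ (s * t)) t = s • γ' (s * t) :=
    (deriv_comp_mul_left s γ t).trans (congrArg (s • ·) (hγ' (s * t)).deriv)
  refine sInf_le ⟨fun t => γ (s * t), 0, 1, zero_le_one, ⟨fun t _ => hmem _, 1, fun k => k,
    Nat.mono_cast, Nat.cast_zero, Nat.cast_one, fun k _ =>
      (hγ.comp (contDiff_const.mul contDiff_id)).contDiffOn⟩, by simp, by simp, ?_⟩
  simp [curveLength, hderiv, metric_smul_smul, hspeed, ← mul_pow, sqrt_sq_eq_abs, abs_mul,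
    abs_of_nonneg hv, mul_comm]

theorem cutTime_le {T : ℝ} (h : ∀ t, T < t → stiefelDist β (γ 0) (γ t) < ENNReal.ofReal t) :
    cutTime β γ ≤ ENNReal.ofReal T := by
  refine sSup_le ?_
  rintro _ ⟨t, _, hdist, rfl⟩
  exact ENNReal.ofReal_le_ofReal (not_lt.1 fun hTt => (h t hTt).ne hdist)

theorem injRadius_le_cutTime (hγ : IsGeodesic β γ)
    (hunit : metric β (γ 0) (deriv γ 0) (deriv γ 0) = 1) : injRadius n p β ≤ cutTime β γ := by
  have htan : deriv γ 0 ∈ tangentSpace (γ 0) :=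
    mem_tangentSpace_of_hasDerivAt hγ.mem (hγ.smooth.differentiable (by simp) 0).hasDerivAt
  exact (sInf_le ⟨γ 0, hγ.mem 0, rfl⟩ : injRadius n p β ≤ injRadiusAt β (γ 0)).trans
    (sInf_le ⟨deriv γ 0, ⟨htan, hunit⟩, γ, hγ, rfl, rfl, rfl⟩)

theorem injRadius_le_of_stiefelDist_lt (hγ : IsGeodesic β γ) {v T : ℝ} (hv : 0 < v)
    (hspeed : metric β (γ 0) (deriv γ 0) (deriv γ 0) = v ^ 2)
    (h : ∀ t, T < t → stiefelDist β (γ 0) (γ t) < ENNReal.ofReal (v * t)) :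
    injRadius n p β ≤ ENNReal.ofReal (v * T) := by
  have hderiv : deriv (fun t => γ (v⁻¹ * t)) 0 = v⁻¹ • deriv γ (v⁻¹ * 0) :=
    deriv_comp_mul_left v⁻¹ γ 0
  refine (injRadius_le_cutTime (hγ.comp_const_mul (inv_pos.2 hv)) ?_).trans
    (cutTime_le fun t ht => ?_)
  · rw [hderiv, metric_smul_smul, mul_zero, hspeed, ← mul_pow, inv_mul_cancel₀ hv.ne', one_pow]
  · have hlt := h (v⁻¹ * t) (by rwa [lt_inv_mul_iff₀ hv])
    rwa [mul_inv_cancel_left₀ hv.ne', ← mul_zero v⁻¹] at hlt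

theorem injRadius_le_of_periodic (hγ : IsGeodesic β γ) {v T L : ℝ} (hv : 0 < v) (hL : 0 < L)
    (hspeed : ∀ t, metric β (γ t) (deriv γ t) (deriv γ t) = v ^ 2)
    (hper : Function.Periodic γ (2 * L))
    (h : ∀ t ∈ Ioc T L, stiefelDist β (γ 0) (γ t) < ENNReal.ofReal (v * t)) :
    injRadius n p β ≤ ENNReal.ofReal (v * T) := by
  refine injRadius_le_of_stiefelDist_lt hγ hv (hspeed 0) fun t hTt => ?_
  rcases le_or_gt t L with htL | hLt
  · exact h t ⟨hTt, htL⟩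
  obtain ⟨s, hs, hst⟩ := hper.exists_mem_Ioc (mul_pos two_pos hL) t (-L)
  have hsL : |s| ≤ L := abs_le.2 ⟨hs.1.le, by linarith [hs.2]⟩
  rw [hst]
  refine (stiefelDist_le_of_metric_eq (hγ.smooth.of_le (by simp)) hγ.mem
    (fun t => (hγ.smooth.differentiable (by simp) t).hasDerivAt) hv.le hspeed s).trans_lt ?_
  rw [ENNReal.ofReal_lt_ofReal_iff (mul_pos hv (hL.trans hLt))]
  exact mul_lt_mul_of_pos_left (hsL.trans_lt hLt) hv

end InjectivityRadius

/-- A point `X` of `St(n,p)` together with an `m`-frame `Y` normal to its columns and an `m`-frame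
`W` of `ℝᵖ`: the data of an isometric embedding of `St(2m,m)` into `St(n,p)`. -/
structure AdaptedFrame (n p m : ℕ) where
  X : Matrix (Fin n) (Fin p) ℝ
  Y : Matrix (Fin n) (Fin m) ℝ
  W : Matrix (Fin p) (Fin m) ℝ
  X_orth : Xᵀ * X = 1
  Y_orth : Yᵀ * Y = 1
  W_orth : Wᵀ * W = 1
  X_perp_Y : Xᵀ * Y = 0

theorem nonempty_adaptedFrame {n p m : ℕ} (hm : m ≤ p) (hpm : p + m ≤ n) :
    Nonempty (AdaptedFrame n p m) := by
  have submatrix_one_mul {k l N : ℕ} (f : Fin k → Fin N) (g : Fin l → Fin N) :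
      ((1 : Matrix (Fin N) (Fin N) ℝ).submatrix id f)ᵀ
        * (1 : Matrix (Fin N) (Fin N) ℝ).submatrix id g
        = (1 : Matrix (Fin N) (Fin N) ℝ).submatrix f g := by
    rw [Matrix.transpose_submatrix, ← Matrix.submatrix_mul _ _ _ _ _ Function.bijective_id,
      Matrix.transpose_one, Matrix.one_mul]
  have orth {k N : ℕ} {f : Fin k → Fin N} (hf : Function.Injective f) :
      ((1 : Matrix (Fin N) (Fin N) ℝ).submatrix id f)ᵀ
        * (1 : Matrix (Fin N) (Fin N) ℝ).submatrix id f = 1 := by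
    rw [submatrix_one_mul, Matrix.submatrix_one f hf]
  let first : Fin p → Fin n := Fin.castLE (by omega)
  let next : Fin m → Fin n := fun i => Fin.castLE hpm (Fin.natAdd p i)
  exact ⟨{
    X := (1 : Matrix (Fin n) (Fin n) ℝ).submatrix id first
    Y := (1 : Matrix (Fin n) (Fin n) ℝ).submatrix id next
    W := (1 : Matrix (Fin p) (Fin p) ℝ).submatrix id (Fin.castLE hm)
    X_orth := orth (Fin.castLE_injective _)
    Y_orth := orth ((Fin.castLE_injective hpm).comp (Fin.natAdd_injective m p))
    W_orth := orth (Fin.castLE_injective hm)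
    X_perp_Y := by
      rw [submatrix_one_mul]
      ext i j
      have hij : first i ≠ next j := fun h => by
        have := congrArg Fin.val h
        simp only [first, next, Fin.val_castLE, Fin.val_natAdd] at this
        omega
      exact Matrix.one_apply_ne hij }⟩

namespace AdaptedFrame

variable {n p m : ℕ} (F : AdaptedFrame n p m)

/-- The linear part of `AdaptedFrame.embed`. -/
def lin (B C : Matrix (Fin m) (Fin m) ℝ) : Matrix (Fin n) (Fin p) ℝ :=
  (F.X * F.W * B + F.Y * C) * F.Wᵀ

/-- The isometric embedding of `St(2m,m)` into `St(n,p)`: the `2m × m` matrix with blocks `B` and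
`C` acts on the range of `W`, and the complement of that range is mapped by `X`. -/
def embed (B C : Matrix (Fin m) (Fin m) ℝ) : Matrix (Fin n) (Fin p) ℝ :=
  F.X * (1 - F.W * F.Wᵀ) + F.lin B C

theorem lin_transpose_mul_lin (B C B' C' : Matrix (Fin m) (Fin m) ℝ) :
    (F.lin B C)ᵀ * F.lin B' C' = F.W * (Bᵀ * B' + Cᵀ * C') * F.Wᵀ := by
  have Y_perp_X : F.Yᵀ * F.X = 0 := by simpa using congrArg Matrix.transpose F.X_perp_Y
  have hXX (D : Matrix (Fin p) (Fin m) ℝ) : F.Xᵀ * (F.X * D) = D := by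
    rw [← Matrix.mul_assoc, F.X_orth, Matrix.one_mul]
  have hWW (D : Matrix (Fin m) (Fin m) ℝ) : F.Wᵀ * (F.W * D) = D := by
    rw [← Matrix.mul_assoc, F.W_orth, Matrix.one_mul]
  have hYY (D : Matrix (Fin m) (Fin m) ℝ) : F.Yᵀ * (F.Y * D) = D := by
    rw [← Matrix.mul_assoc, F.Y_orth, Matrix.one_mul]
  have hXY (D : Matrix (Fin m) (Fin m) ℝ) : F.Xᵀ * (F.Y * D) = 0 := by
    rw [← Matrix.mul_assoc, F.X_perp_Y, Matrix.zero_mul]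
  have hYX (D : Matrix (Fin p) (Fin m) ℝ) : F.Yᵀ * (F.X * D) = 0 := by
    rw [← Matrix.mul_assoc, Y_perp_X, Matrix.zero_mul]
  have hcore : (F.X * F.W * B + F.Y * C)ᵀ * (F.X * F.W * B' + F.Y * C')
      = Bᵀ * B' + Cᵀ * C' := by
    simp only [Matrix.transpose_add, Matrix.transpose_mul, Matrix.add_mul, Matrix.mul_add,
      Matrix.mul_assoc, hXX, hWW, hYY, hXY, hYX, Matrix.mul_zero, add_zero, zero_add]
  rw [lin, lin, Matrix.transpose_mul, Matrix.transpose_transpose, Matrix.mul_assoc,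
    ← Matrix.mul_assoc (_ᵀ), hcore, ← Matrix.mul_assoc]

theorem complement_mul_W : (1 - F.W * F.Wᵀ) * F.W = 0 := by
  rw [Matrix.sub_mul, Matrix.mul_assoc, F.W_orth, Matrix.mul_one, Matrix.one_mul, sub_self]

theorem complement_isSymm : (1 - F.W * F.Wᵀ).IsSymm := by
  simp [Matrix.IsSymm]

theorem complement_transpose_mul_lin (B C : Matrix (Fin m) (Fin m) ℝ) :
    (F.X * (1 - F.W * F.Wᵀ))ᵀ * F.lin B C = 0 := by
  have h : F.Xᵀ * (F.X * F.W * B + F.Y * C) = F.W * B := by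
    rw [Matrix.mul_add, ← Matrix.mul_assoc, ← Matrix.mul_assoc, ← Matrix.mul_assoc, F.X_orth,
      F.X_perp_Y, Matrix.one_mul, Matrix.zero_mul, add_zero]
  rw [lin, Matrix.transpose_mul, F.complement_isSymm.eq, Matrix.mul_assoc, ← Matrix.mul_assoc F.Xᵀ,
    h, ← Matrix.mul_assoc, ← Matrix.mul_assoc, F.complement_mul_W, Matrix.zero_mul,
    Matrix.zero_mul]

theorem embed_transpose_mul_lin (B C B' C' : Matrix (Fin m) (Fin m) ℝ) :
    (F.embed B C)ᵀ * F.lin B' C' = F.W * (Bᵀ * B' + Cᵀ * C') * F.Wᵀ := by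
  rw [embed, Matrix.transpose_add, Matrix.add_mul, F.complement_transpose_mul_lin, zero_add,
    F.lin_transpose_mul_lin]

theorem embed_mem_stiefel {B C : Matrix (Fin m) (Fin m) ℝ} (h : Bᵀ * B + Cᵀ * C = 1) :
    F.embed B C ∈ stiefel n p := by
  have hQ : (F.X * (1 - F.W * F.Wᵀ))ᵀ * (F.X * (1 - F.W * F.Wᵀ)) = 1 - F.W * F.Wᵀ := by
    rw [Matrix.transpose_mul, Matrix.mul_assoc, ← Matrix.mul_assoc F.Xᵀ, F.X_orth, Matrix.one_mul,
      F.complement_isSymm.eq, Matrix.mul_sub, ← Matrix.mul_assoc, F.complement_mul_W,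
      Matrix.mul_one, Matrix.zero_mul, sub_zero]
  have hcross : (F.lin B C)ᵀ * (F.X * (1 - F.W * F.Wᵀ)) = 0 := by
    simpa using congrArg Matrix.transpose (F.complement_transpose_mul_lin B C)
  change (F.embed B C)ᵀ * F.embed B C = 1
  conv_lhs => rw [embed]
  rw [Matrix.transpose_add, Matrix.add_mul, Matrix.mul_add, Matrix.mul_add, hQ, hcross,
    F.complement_transpose_mul_lin, F.lin_transpose_mul_lin, h, Matrix.mul_one]
  abel

theorem embed_mul (B C S : Matrix (Fin m) (Fin m) ℝ) :
    F.embed B C * (F.W * S * F.Wᵀ) = F.lin (B * S) (C * S) := by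
  have hW : F.Wᵀ * (F.W * S * F.Wᵀ) = S * F.Wᵀ := by
    rw [← Matrix.mul_assoc, ← Matrix.mul_assoc, F.W_orth, Matrix.one_mul]
  rw [embed, Matrix.add_mul, Matrix.mul_assoc F.X, ← Matrix.mul_assoc (1 - _), ← Matrix.mul_assoc
    (1 - _), F.complement_mul_W, Matrix.zero_mul, Matrix.zero_mul, Matrix.mul_zero, zero_add, lin,
    Matrix.mul_assoc, hW, lin]
  simp only [Matrix.add_mul, Matrix.mul_assoc]

theorem metric_embed (β : ℝ) (B C B' C' : Matrix (Fin m) (Fin m) ℝ) :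
    metric β (F.embed B C) (F.lin B' C') (F.lin B' C') = (B'ᵀ * B' + C'ᵀ * C').trace
      + (β - 1) * ((Bᵀ * B' + Cᵀ * C')ᵀ * (Bᵀ * B' + Cᵀ * C')).trace := by
  have trace_conj (D : Matrix (Fin m) (Fin m) ℝ) : (F.W * D * F.Wᵀ).trace = D.trace := by
    rw [Matrix.trace_mul_comm, ← Matrix.mul_assoc, F.W_orth, Matrix.one_mul]
  have conj_transpose_mul (D : Matrix (Fin m) (Fin m) ℝ) :
      (F.W * D * F.Wᵀ)ᵀ * (F.W * D * F.Wᵀ) = F.W * (Dᵀ * D) * F.Wᵀ := by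
    rw [Matrix.transpose_mul, Matrix.transpose_mul, Matrix.transpose_transpose]
    simp only [Matrix.mul_assoc]
    rw [← Matrix.mul_assoc F.Wᵀ F.W, F.W_orth, Matrix.one_mul]
  rw [metric_eq_trace_add, F.embed_transpose_mul_lin, F.lin_transpose_mul_lin, conj_transpose_mul,
    trace_conj, trace_conj]

variable {B' C' : Matrix (Fin m) (Fin m) ℝ}

theorem hasDerivAt_lin {b c : ℝ → Matrix (Fin m) (Fin m) ℝ} {t : ℝ} (hb : HasDerivAt b B' t)
    (hc : HasDerivAt c C' t) :
    HasDerivAt (fun t => F.lin (b t) (c t)) (F.lin B' C') t := by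
  have h := hasDerivAt_matrixMul ((hasDerivAt_matrixMul (hasDerivAt_const t (F.X * F.W)) hb).add
    (hasDerivAt_matrixMul (hasDerivAt_const t F.Y) hc)) (hasDerivAt_const t F.Wᵀ)
  refine h.congr_deriv ?_
  simp only [lin, Matrix.zero_mul, Matrix.mul_zero, add_zero, zero_add]

theorem hasDerivAt_embed {b c : ℝ → Matrix (Fin m) (Fin m) ℝ} {t : ℝ} (hb : HasDerivAt b B' t)
    (hc : HasDerivAt c C' t) :
    HasDerivAt (fun t => F.embed (b t) (c t)) (F.lin B' C') t :=
  (F.hasDerivAt_lin hb hc).const_add (F.X * (1 - F.W * F.Wᵀ))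

theorem contDiff_embed {b c : ℝ → Matrix (Fin m) (Fin m) ℝ} {k : ℕ∞ω} (hb : ContDiff ℝ k b)
    (hc : ContDiff ℝ k c) : ContDiff ℝ k fun t => F.embed (b t) (c t) :=
  contDiff_const.add (contDiff_matrixMul ((contDiff_matrixMul contDiff_const hb).add
    (contDiff_matrixMul contDiff_const hc)) contDiff_const)

end AdaptedFrame

/-- The algebra embedding of `ℂ` into the real `2 × 2` matrices. -/
def complexMatrix : ℂ →ₐ[ℝ] Matrix (Fin 2) (Fin 2) ℝ :=
  Algebra.leftMulMatrix Complex.basisOneI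

theorem complexMatrix_transpose (z : ℂ) : (complexMatrix z)ᵀ = complexMatrix (star z) := by
  ext i j
  fin_cases i <;> fin_cases j <;> simp [complexMatrix, Algebra.leftMulMatrix_complex]

theorem trace_complexMatrix (z : ℂ) : (complexMatrix z).trace = 2 * z.re := by
  simp [complexMatrix, Algebra.leftMulMatrix_complex, Matrix.trace_fin_two, two_mul]

theorem complexMatrix_ofReal (x : ℝ) : complexMatrix x = x • 1 := by
  rw [← Complex.coe_algebraMap, AlgHom.commutes, Algebra.algebraMap_eq_smul_one]

theorem contDiff_complexMatrix {k : ℕ∞ω} : ContDiff ℝ k complexMatrix :=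
  (LinearMap.toContinuousLinearMap complexMatrix.toLinearMap).contDiff

theorem hasDerivAt_complexMatrix {u : ℝ → ℂ} {u' : ℂ} {t : ℝ} (hu : HasDerivAt u u' t) :
    HasDerivAt (fun t => complexMatrix (u t)) (complexMatrix u') t :=
  (LinearMap.toContinuousLinearMap complexMatrix.toLinearMap).hasFDerivAt.comp_hasDerivAt t hu

theorem normSq_expMulI (θ : ℝ) : Complex.normSq (Complex.exp (θ * Complex.I)) = 1 := by
  rw [Complex.normSq_eq_norm_sq, Complex.norm_exp_ofReal_mul_I, one_pow]

theorem hasDerivAt_expMulI (w t : ℝ) :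
    HasDerivAt (fun t : ℝ => Complex.exp ((w * t : ℝ) * Complex.I))
      (Complex.exp ((w * t : ℝ) * Complex.I) * (w * Complex.I)) t :=
  ((hasDerivAt_const_mul w).ofReal_comp.mul_const Complex.I).cexp

theorem contDiff_expMulI (w : ℝ) {k : ℕ∞ω} :
    ContDiff ℝ k fun t : ℝ => Complex.exp ((w * t : ℝ) * Complex.I) :=
  ((Complex.ofRealCLM.contDiff.comp (contDiff_const.mul contDiff_id)).mul contDiff_const).cexp

namespace AdaptedFrame

section GreatCircle

variable {n p m : ℕ} (F : AdaptedFrame n p m)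

/-- The horizontal great circle from `F.X` in the direction `F.Y * F.Wᵀ`. -/
def greatCircle (θ : ℝ) : Matrix (Fin n) (Fin p) ℝ :=
  F.embed (cos θ • 1) (sin θ • 1)

theorem greatCircle_mem_stiefel (θ : ℝ) : F.greatCircle θ ∈ stiefel n p := by
  refine F.embed_mem_stiefel ?_
  simp only [Matrix.transpose_smul, Matrix.transpose_one, Matrix.smul_mul, Matrix.mul_smul,
    Matrix.one_mul, smul_smul, ← add_smul]
  rw [← sq, ← sq, cos_sq_add_sin_sq, one_smul]

theorem contDiff_greatCircle {k : ℕ∞ω} : ContDiff ℝ k F.greatCircle :=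
  F.contDiff_embed (contDiff_cos.smul contDiff_const) (contDiff_sin.smul contDiff_const)

theorem hasDerivAt_greatCircle (θ : ℝ) :
    HasDerivAt F.greatCircle (F.lin (-sin θ • 1) (cos θ • 1)) θ :=
  F.hasDerivAt_embed ((hasDerivAt_cos θ).smul_const _) ((hasDerivAt_sin θ).smul_const _)

theorem isGeodesic_greatCircle (β : ℝ) : IsGeodesic β F.greatCircle := by
  refine isGeodesic_of_horizontal
    (S := fun _ => F.W * (-1 : Matrix (Fin m) (Fin m) ℝ) * F.Wᵀ) F.contDiff_greatCircle
    F.greatCircle_mem_stiefel F.hasDerivAt_greatCircle (fun θ => ?_) (fun _ => ?_) fun θ => ?_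
  · simp [greatCircle, F.embed_transpose_mul_lin, smul_smul, mul_comm]
  · simp [Matrix.IsSymm]
  · refine (F.hasDerivAt_lin ((hasDerivAt_sin θ).neg.smul_const _)
      ((hasDerivAt_cos θ).smul_const _)).congr_deriv ?_
    rw [greatCircle, F.embed_mul, mul_neg_one, mul_neg_one, neg_smul, neg_smul]

theorem metric_greatCircle (β θ : ℝ) :
    metric β (F.greatCircle θ) (deriv F.greatCircle θ) (deriv F.greatCircle θ) = √m ^ 2 := by
  have hderiv : deriv F.greatCircle θ = F.lin (-sin θ • 1) (cos θ • 1) :=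
    (F.hasDerivAt_greatCircle θ).deriv
  rw [hderiv, greatCircle, F.metric_embed, sq_sqrt m.cast_nonneg]
  simp only [Matrix.transpose_smul, Matrix.transpose_one, Matrix.smul_mul, Matrix.mul_smul,
    Matrix.one_mul, smul_smul, ← add_smul, Matrix.trace_smul, Matrix.trace_one, smul_eq_mul,
    Fintype.card_fin]
  linear_combination (m : ℝ) * cos_sq_add_sin_sq θ

theorem greatCircle_periodic : Function.Periodic F.greatCircle (2 * π) := fun θ => by
  simp only [greatCircle, cos_add_two_pi, sin_add_two_pi]

end GreatCircle

section BergerSphere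

variable {n p : ℕ} (F : AdaptedFrame n p 2)

/-- The sphere `S³ ⊂ ℂ²` embedded in `St(n,p)`; the metric it inherits is a Berger metric, whose
Hopf fibres are stretched by `√β`. -/
def berger (u v : ℂ) : Matrix (Fin n) (Fin p) ℝ :=
  F.embed (complexMatrix u) (complexMatrix v)

theorem greatCircle_eq_berger (θ : ℝ) : F.greatCircle θ = F.berger (cos θ : ℝ) (sin θ : ℝ) := by
  rw [greatCircle, berger, complexMatrix_ofReal, complexMatrix_ofReal]

theorem berger_mem_stiefel {u v : ℂ} (h : star u * u + star v * v = 1) :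
    F.berger u v ∈ stiefel n p :=
  F.embed_mem_stiefel <| by
    rw [complexMatrix_transpose, complexMatrix_transpose, ← map_mul, ← map_mul, ← map_add, h,
      map_one]

theorem contDiff_berger {u v : ℝ → ℂ} {k : ℕ∞ω} (hu : ContDiff ℝ k u) (hv : ContDiff ℝ k v) :
    ContDiff ℝ k fun t => F.berger (u t) (v t) :=
  F.contDiff_embed (contDiff_complexMatrix.comp hu) (contDiff_complexMatrix.comp hv)

theorem hasDerivAt_berger {u v : ℝ → ℂ} {u' v' : ℂ} {t : ℝ} (hu : HasDerivAt u u' t)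
    (hv : HasDerivAt v v' t) : HasDerivAt (fun t => F.berger (u t) (v t))
      (F.lin (complexMatrix u') (complexMatrix v')) t :=
  F.hasDerivAt_embed (hasDerivAt_complexMatrix hu) (hasDerivAt_complexMatrix hv)

theorem metric_berger (β : ℝ) (u v u' v' : ℂ) :
    metric β (F.berger u v) (F.lin (complexMatrix u') (complexMatrix v'))
        (F.lin (complexMatrix u') (complexMatrix v'))
      = 2 * (Complex.normSq u' + Complex.normSq v'
        + (β - 1) * Complex.normSq (star u * u' + star v * v')) := by
  have hre (z : ℂ) : (star z * z).re = Complex.normSq z := by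
    rw [Complex.star_def, ← Complex.normSq_eq_conj_mul_self, Complex.ofReal_re]
  rw [berger, F.metric_embed]
  simp only [complexMatrix_transpose, ← map_mul, ← map_add, trace_complexMatrix, Complex.add_re,
    hre]
  ring

/-- The great circle of `S³` with initial velocity `(i * k, z)`, multiplied at time `t` by the
scalar `exp (i * w * t)`. For `k = 1` and `w = z = 0` it is the Hopf fibre through `F.X`. -/
def twistedCircle (w k : ℝ) (z : ℂ) (t : ℝ) : Matrix (Fin n) (Fin p) ℝ :=
  F.berger (Complex.exp ((w * t : ℝ) * Complex.I) * (cos t + k * sin t * Complex.I))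
    (Complex.exp ((w * t : ℝ) * Complex.I) * (z * sin t))

variable {w k : ℝ} {z : ℂ}

theorem twistedCircle_mem_stiefel (h : k ^ 2 + Complex.normSq z = 1) (t : ℝ) :
    F.twistedCircle w k z t ∈ stiefel n p := by
  refine F.berger_mem_stiefel ?_
  simp only [Complex.star_def, ← Complex.normSq_eq_conj_mul_self, Complex.normSq_mul,
    normSq_expMulI, one_mul, Complex.normSq_ofReal]
  rw [← Complex.ofReal_mul k, Complex.normSq_add_mul_I, ← Complex.ofReal_add, Complex.ofReal_eq_one]
  linear_combination sin t ^ 2 * h + sin_sq_add_cos_sq t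

theorem contDiff_twistedCircle {N : ℕ∞ω} : ContDiff ℝ N (F.twistedCircle w k z) := by
  have hcos : ContDiff ℝ N fun t : ℝ => (cos t : ℂ) := Complex.ofRealCLM.contDiff.comp contDiff_cos
  have hsin : ContDiff ℝ N fun t : ℝ => (sin t : ℂ) := Complex.ofRealCLM.contDiff.comp contDiff_sin
  exact F.contDiff_berger
    ((contDiff_expMulI w).mul (hcos.add ((contDiff_const.mul hsin).mul contDiff_const)))
    ((contDiff_expMulI w).mul (contDiff_const.mul hsin))

/-- The velocity of `AdaptedFrame.twistedCircle`. -/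
def twistedCircleDeriv (w k : ℝ) (z : ℂ) (t : ℝ) : Matrix (Fin n) (Fin p) ℝ :=
  F.lin
    (complexMatrix (Complex.exp ((w * t : ℝ) * Complex.I)
      * (w * Complex.I * (cos t + k * sin t * Complex.I) + (-sin t + k * cos t * Complex.I))))
    (complexMatrix (Complex.exp ((w * t : ℝ) * Complex.I)
      * (w * Complex.I * (z * sin t) + z * cos t)))

theorem hasDerivAt_twistedCircle (t : ℝ) :
    HasDerivAt (F.twistedCircle w k z) (F.twistedCircleDeriv w k z t) t := by
  have hcos : HasDerivAt (fun t : ℝ => (cos t : ℂ)) (-sin t : ℂ) t := by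
    simpa using (hasDerivAt_cos t).ofReal_comp
  have hsin : HasDerivAt (fun t : ℝ => (sin t : ℂ)) (cos t : ℂ) t :=
    (hasDerivAt_sin t).ofReal_comp
  have hu := (hasDerivAt_expMulI w t).fun_mul
    (hcos.fun_add ((hsin.const_mul (k : ℂ)).mul_const Complex.I))
  have hv := (hasDerivAt_expMulI w t).fun_mul (hsin.const_mul z)
  exact F.hasDerivAt_berger (hu.congr_deriv (by ring)) (hv.congr_deriv (by ring))

theorem twistedCircle_fibre_component (h : k ^ 2 + Complex.normSq z = 1) (t : ℝ) :
    star (cos t + k * sin t * Complex.I : ℂ)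
        * (w * Complex.I * (cos t + k * sin t * Complex.I) + (-sin t + k * cos t * Complex.I))
      + star (z * sin t) * (w * Complex.I * (z * sin t) + z * cos t)
      = (w + k : ℝ) * Complex.I := by
  have hconj : star (cos t + k * sin t * Complex.I : ℂ) = cos t - k * sin t * Complex.I := by
    simp [-Complex.ofReal_cos, -Complex.ofReal_sin, ← sub_eq_add_neg]
  have hnorm : star z * z = 1 - k ^ 2 := by
    rw [Complex.star_def, ← Complex.normSq_eq_conj_mul_self, eq_sub_of_add_eq' h]
    push_cast
    ring
  have hcs : (cos t : ℂ) ^ 2 + (sin t : ℂ) ^ 2 = 1 := mod_cast cos_sq_add_sin_sq t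
  rw [hconj, star_mul', Complex.star_def, Complex.conj_ofReal, ← Complex.star_def,
    Complex.ofReal_add]
  linear_combination (w * Complex.I * sin t ^ 2 + sin t * cos t) * hnorm
    + (w + k) * Complex.I * hcs
    - k ^ 2 * sin t * (w * sin t * Complex.I + cos t) * Complex.I_sq

theorem metric_twistedCircle (h : k ^ 2 + Complex.normSq z = 1) (β t : ℝ) :
    metric β (F.twistedCircle w k z t) (F.twistedCircleDeriv w k z t)
      (F.twistedCircleDeriv w k z t) = 2 * (Complex.normSq z + β * (w + k) ^ 2) := by
  have hstar (θ : ℝ) (y y' : ℂ) : star (Complex.exp (θ * Complex.I) * y)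
      * (Complex.exp (θ * Complex.I) * y') = star y * y' := by
    rw [star_mul', mul_mul_mul_comm, Complex.star_def, ← Complex.normSq_eq_conj_mul_self,
      normSq_expMulI, Complex.ofReal_one, one_mul]
  have hu : w * Complex.I * (cos t + k * sin t * Complex.I) + (-sin t + k * cos t * Complex.I)
      = (-(w * k + 1) * sin t : ℝ) + ((w + k) * cos t : ℝ) * Complex.I := by
    rw [Complex.ofReal_mul, Complex.ofReal_mul]
    push_cast
    linear_combination w * k * Complex.sin t * Complex.I_sq
  have hv : w * Complex.I * (z * sin t) + z * cos t
      = z * ((cos t : ℝ) + (w * sin t : ℝ) * Complex.I) := by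
    rw [Complex.ofReal_mul]
    ring
  rw [twistedCircle, twistedCircleDeriv, F.metric_berger, hstar, hstar,
    twistedCircle_fibre_component h, Complex.normSq_mul, Complex.normSq_mul, Complex.normSq_mul,
    normSq_expMulI, hu, hv, Complex.normSq_mul, Complex.normSq_add_mul_I, Complex.normSq_add_mul_I,
    Complex.normSq_ofReal, Complex.normSq_I]
  linear_combination 2 * (w ^ 2 - 1) * sin t ^ 2 * h
    + 2 * ((w + k) ^ 2 + Complex.normSq z) * cos_sq_add_sin_sq t

theorem twistedCircle_hopf (t : ℝ) :
    F.twistedCircle 0 1 0 t = F.berger (Complex.exp (t * Complex.I)) 0 := by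
  simp [twistedCircle, Complex.exp_mul_I]

theorem isGeodesic_hopfFibre (β : ℝ) : IsGeodesic β (F.twistedCircle 0 1 0) := by
  refine isGeodesic_of_vertical (J := F.W * complexMatrix Complex.I * F.Wᵀ)
    F.contDiff_twistedCircle (F.twistedCircle_mem_stiefel (by simp)) fun t =>
      (F.hasDerivAt_twistedCircle t).congr_deriv ?_
  rw [twistedCircle_hopf, berger, F.embed_mul, ← map_mul, ← map_mul, zero_mul, twistedCircleDeriv]
  congr 2
  · simp only [zero_mul, Complex.ofReal_zero, Complex.exp_zero, one_mul, zero_add,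
      Complex.ofReal_one, Complex.ofReal_cos, Complex.ofReal_sin, Complex.exp_mul_I]
    linear_combination -Complex.sin t * Complex.I_sq
  · simp only [zero_mul, mul_zero, add_zero]

theorem hopfFibre_periodic : Function.Periodic (F.twistedCircle 0 1 0) (2 * π) := fun t => by
  simp only [twistedCircle, zero_mul, cos_add_two_pi, sin_add_two_pi]

theorem twistedCircle_eq_greatCircle {T τ ψ k : ℝ} (hτ : τ ≠ 0) (hsin : sin τ ≠ 0)
    (hu : cos τ = cos T * cos ψ) (hv : k * sin τ = -(cos T * sin ψ)) :
    F.twistedCircle (ψ / τ) k (Complex.exp ((-ψ : ℝ) * Complex.I) * (sin T / sin τ : ℝ)) τ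
      = F.greatCircle T := by
  have hexp : Complex.exp (ψ * Complex.I) * Complex.exp ((-ψ : ℝ) * Complex.I) = 1 := by
    rw [← Complex.exp_add, ← add_mul, ← Complex.ofReal_add, add_neg_cancel, Complex.ofReal_zero,
      zero_mul, Complex.exp_zero]
  have hcos : cos τ + k * sin τ * Complex.I
      = cos T * Complex.exp ((-ψ : ℝ) * Complex.I) := by
    rw [Complex.exp_mul_I, ← Complex.ofReal_cos, ← Complex.ofReal_sin, cos_neg, sin_neg, hu,
      ← Complex.ofReal_mul k, hv]
    push_cast
    ring
  have hsin' : ((sin T / sin τ : ℝ) : ℂ) * sin τ = sin T := by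
    rw [← Complex.ofReal_mul, div_mul_cancel₀ _ hsin]
  rw [twistedCircle, greatCircle_eq_berger, div_mul_cancel₀ _ hτ, hcos, mul_assoc _ _ (sin τ : ℂ),
    hsin', mul_left_comm, ← mul_assoc (Complex.exp _), hexp, mul_one, one_mul]

theorem stiefelDist_greatCircle_le {β T τ ψ k : ℝ} (hτ : 0 < τ) (hsin : sin τ ≠ 0)
    (hu : cos τ = cos T * cos ψ) (hv : k * sin τ = -(cos T * sin ψ)) (hβ : 0 ≤ β) :
    stiefelDist β (F.greatCircle 0) (F.greatCircle T) ≤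
      ENNReal.ofReal √(2 * ((τ * (sin T / sin τ)) ^ 2 + β * (ψ + k * τ) ^ 2)) := by
  set w := ψ / τ with hw
  set z := Complex.exp ((-ψ : ℝ) * Complex.I) * (sin T / sin τ : ℝ)
  have hz : Complex.normSq z = (sin T / sin τ) ^ 2 := by
    rw [Complex.normSq_mul, normSq_expMulI, one_mul, Complex.normSq_ofReal, sq]
  have hunit : k ^ 2 + Complex.normSq z = 1 := by
    rw [hz, div_pow, eq_div_of_mul_eq hsin hv, div_pow, ← add_div,
      div_eq_one_iff_eq (by positivity)]
    have hcos := congrArg (· ^ 2) hu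
    linear_combination sin_sq_add_cos_sq T + cos T ^ 2 * sin_sq_add_cos_sq ψ + hcos
      - sin_sq_add_cos_sq τ
  have hleft : F.twistedCircle w k z 0 = F.greatCircle 0 := by
    simp [twistedCircle, greatCircle_eq_berger]
  have hright : F.twistedCircle w k z τ = F.greatCircle T :=
    F.twistedCircle_eq_greatCircle hτ.ne' hsin hu hv
  have hspeed : 0 ≤ 2 * (Complex.normSq z + β * (w + k) ^ 2) :=
    mul_nonneg zero_le_two (add_nonneg (Complex.normSq_nonneg z) (mul_nonneg hβ (sq_nonneg _)))
  rw [← hleft, ← hright]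
  refine (stiefelDist_le_of_metric_eq F.contDiff_twistedCircle (F.twistedCircle_mem_stiefel hunit)
    F.hasDerivAt_twistedCircle (sqrt_nonneg (2 * (Complex.normSq z + β * (w + k) ^ 2)))
    (fun t => ?_) τ).trans_eq ?_
  · rw [F.metric_twistedCircle hunit, sq_sqrt hspeed]
  · rw [← sqrt_sq_eq_abs, ← sqrt_mul hspeed, hz, hw]
    congr 2
    field_simp

end BergerSphere

end AdaptedFrame

section GeodesicBounds

variable {n p : ℕ} {β : ℝ}

theorem injRadius_le_pi (hp : 1 ≤ p) (hpn : p + 1 ≤ n) : injRadius n p β ≤ ENNReal.ofReal π := by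
  obtain ⟨F⟩ := nonempty_adaptedFrame hp hpn
  simpa using injRadius_le_of_periodic (F.isGeodesic_greatCircle β) (T := π) (by simp) pi_pos
    (F.metric_greatCircle β) F.greatCircle_periodic (by simp)

theorem injRadius_le_sqrt_two_mul_pi (hp : 2 ≤ p) (hpn : p + 2 ≤ n) (hβ : 0 < β) :
    injRadius n p β ≤ ENNReal.ofReal (√(2 * β) * π) := by
  obtain ⟨F⟩ := nonempty_adaptedFrame hp hpn
  refine injRadius_le_of_periodic (F.isGeodesic_hopfFibre β) (sqrt_pos.2 (by positivity)) pi_pos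
    (fun t => ?_) F.hopfFibre_periodic (by simp)
  have hderiv : deriv (F.twistedCircle 0 1 0) t = F.twistedCircleDeriv 0 1 0 t :=
    (F.hasDerivAt_twistedCircle t).deriv
  rw [hderiv, F.metric_twistedCircle (by simp), sq_sqrt (by positivity)]
  simp

end GeodesicBounds

section Conjugate

/-- The left-hand side of the equation for `t^r_β`, with `κ = (1 - β) / β`. At its zeros `t > 0` the
great circle has a conjugate point at distance `√2 * t`. -/
def conjugateFun (κ t : ℝ) : ℝ := sinc t + κ * cos t

variable {κ r t : ℝ}

theorem conjugateFun_of_pos (ht : 0 < t) : conjugateFun κ t = sin t / t + κ * cos t := by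
  rw [conjugateFun, sinc_of_ne_zero ht.ne']

theorem continuous_conjugateFun : Continuous (conjugateFun κ) := by
  unfold conjugateFun
  fun_prop

theorem cos_lt_sinc (h0 : 0 < t) (h : t ≤ π / 2) : cos t < sinc t := by
  rw [sinc_of_ne_zero h0.ne', lt_div_iff₀ h0]
  rcases h.lt_or_eq with h | rfl
  · have hcos : 0 < cos t := cos_pos_of_mem_Ioo ⟨by linarith, h⟩
    have htan := lt_tan h0 h
    rwa [tan_eq_sin_div_cos, lt_div_iff₀ hcos, mul_comm] at htan
  · simp

theorem conjugateFun_pos_of_le_pi_div_two (hκ : -1 < κ) (h0 : 0 < t) (h : t ≤ π / 2) :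
    0 < conjugateFun κ t := by
  have hcos : 0 ≤ cos t := cos_nonneg_of_mem_Icc ⟨by linarith, h⟩
  rw [conjugateFun]
  linarith [cos_lt_sinc h0 h, mul_nonneg (neg_lt_iff_pos_add.1 hκ).le hcos]

theorem exists_isLeast_conjugateFun_zero (hκ : -1 < κ) :
    ∃ r, IsLeast {t | 0 < t ∧ conjugateFun κ t = 0} r := by
  have hπ := pi_pos
  have hfinal : conjugateFun κ (3 * π / 2) < 0 := by
    have h : 3 * π / 2 = π / 2 + π := by ring
    rw [conjugateFun_of_pos (by positivity), h, sin_add_pi, cos_add_pi, sin_pi_div_two,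
      cos_pi_div_two, neg_zero, mul_zero, add_zero]
    exact div_neg_of_neg_of_pos (by norm_num) (by positivity)
  obtain ⟨s, hs, hs0⟩ : ∃ s ∈ Icc (π / 2) (3 * π / 2), conjugateFun κ s = 0 :=
    intermediate_value_Icc' (by linarith) continuous_conjugateFun.continuousOn
      ⟨hfinal.le, (conjugateFun_pos_of_le_pi_div_two hκ (by positivity) le_rfl).le⟩
  obtain ⟨r, ⟨hr, hr0⟩, hleast⟩ : ∃ r, IsLeast (Icc (π / 2) s ∩ conjugateFun κ ⁻¹' {0}) r :=
    (isCompact_Icc.inter_right (isClosed_singleton.preimage continuous_conjugateFun)).exists_isLeast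
      ⟨s, right_mem_Icc.2 hs.1, hs0⟩
  refine ⟨r, ⟨by linarith [hr.1], hr0⟩, fun t ⟨ht, ht0⟩ => ?_⟩
  rcases le_total s t with hst | hts
  · exact hr.2.trans hst
  · exact hleast ⟨⟨(not_le.1 fun h => (conjugateFun_pos_of_le_pi_div_two hκ ht h).ne' ht0).le,
      hts⟩, ht0⟩

theorem pi_le_of_conjugateFun_eq_zero (hκ : -1 < κ) (hκ0 : κ ≤ 0) (h0 : 0 < t)
    (h : conjugateFun κ t = 0) : π ≤ t := by
  by_contra! ht
  have hlt : π / 2 < t := not_le.1 fun hle =>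
    (conjugateFun_pos_of_le_pi_div_two hκ h0 hle).ne' h
  have hsin : 0 < sin t / t := div_pos (sin_pos_of_pos_of_lt_pi h0 ht) h0
  have hcos : cos t ≤ 0 := cos_nonpos_of_pi_div_two_le_of_le hlt.le (by linarith [pi_pos])
  rw [conjugateFun_of_pos h0] at h
  linarith [mul_nonneg_of_nonpos_of_nonpos hκ0 hcos]

theorem conjugateFun_strictAntiOn (hκ : 0 < κ) :
    StrictAntiOn (conjugateFun κ) (Icc (π / 2) π) := by
  intro s hs t ht hst
  have hπ := pi_pos
  have hs0 : 0 < s := by linarith [hs.1]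
  have hsin : sin t ≤ sin s := by
    rw [← cos_sub_pi_div_two, ← cos_sub_pi_div_two]
    exact cos_le_cos_of_nonneg_of_le_pi (by linarith [hs.1]) (by linarith [ht.2]) (by linarith)
  have hcos : cos t < cos s := cos_lt_cos_of_nonneg_of_le_pi hs0.le ht.2 hst
  rw [conjugateFun_of_pos hs0, conjugateFun_of_pos (hs0.trans hst)]
  exact add_lt_add_of_le_of_lt (div_le_div₀ (sin_nonneg_of_nonneg_of_le_pi hs0.le hs.2) hsin hs0
    hst.le) (mul_lt_mul_of_pos_left hcos hκ)

theorem conjugateFun_neg (hκ : 0 < κ) (hr0 : 0 < r) (hr : conjugateFun κ r = 0) (hrt : r < t)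
    (ht : t ≤ π) : conjugateFun κ t < 0 := by
  have h : π / 2 ≤ r := (not_le.1 fun h =>
    (conjugateFun_pos_of_le_pi_div_two (by linarith) hr0 h).ne' hr).le
  rw [← hr]
  exact conjugateFun_strictAntiOn hκ ⟨h, hrt.le.trans ht⟩ ⟨h.trans hrt.le, ht⟩ hrt

end Conjugate

section Shortcut

variable {β T : ℝ}

/-- An upper bound for half the difference of the squared lengths of the twisted circle that reaches
`greatCircle T` at time `τ` and of the great circle itself. With `cos τ = cos T * cos ψ`, the angles
`ψ` and `sin ψ` in the length are replaced by `tan ψ`. -/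
def energyExcess (β T τ : ℝ) : ℝ :=
  (sin T * (τ / sin τ)) ^ 2 - T ^ 2
    + β * ((cos T / cos τ) ^ 2 - 1) * (1 - cos T * (τ / sin τ)) ^ 2

theorem energyExcess_self (hsin : sin T ≠ 0) (hcos : cos T ≠ 0) : energyExcess β T T = 0 := by
  rw [energyExcess, mul_div_cancel₀ _ hsin, div_self hcos]
  ring

theorem hasDerivAt_energyExcess (hsin : sin T ≠ 0) (hcos : cos T ≠ 0) :
    HasDerivAt (energyExcess β T) (2 * (sin T - T * cos T) / (sin T * cos T)
      * (T * cos T + β * (sin T - T * cos T))) T := by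
  have hq : HasDerivAt (fun τ => τ / sin τ) ((1 * sin T - T * cos T) / sin T ^ 2) T :=
    (hasDerivAt_id T).fun_div (hasDerivAt_sin T) hsin
  have hc : HasDerivAt (fun τ => cos T / cos τ) ((0 * cos T - cos T * -sin T) / cos T ^ 2) T :=
    (hasDerivAt_const T _).fun_div (hasDerivAt_cos T) hcos
  refine ((((hq.const_mul (sin T)).fun_pow 2).sub_const (T ^ 2)).fun_add
    ((((hc.fun_pow 2).sub_const 1).const_mul β).fun_mul
      (((hq.const_mul (cos T)).const_sub 1).fun_pow 2))).congr_deriv ?_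
  rw [div_self hcos]
  field_simp
  ring

theorem exists_energyExcess_neg (hβ : 0 < β) (hT : π / 2 < T) (hTπ : T < π)
    (hneg : conjugateFun ((1 - β) / β) T < 0) : ∃ τ ∈ Ioo (π / 2) T, energyExcess β T τ < 0 := by
  have hT0 : 0 < T := pi_div_two_pos.trans hT
  have hsin : 0 < sin T := sin_pos_of_pos_of_lt_pi hT0 hTπ
  have hcos : cos T < 0 := cos_neg_of_pi_div_two_lt_of_lt hT (by linarith [pi_pos])
  have hpos : 0 < sin T - T * cos T := by linarith [mul_neg_of_pos_of_neg hT0 hcos]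
  have hconj : T * cos T + β * (sin T - T * cos T) < 0 := by
    have h := mul_neg_of_pos_of_neg (mul_pos hβ hT0) hneg
    rw [conjugateFun_of_pos hT0] at h
    field_simp at h
    linarith
  have hderiv : 0 < deriv (energyExcess β T) T := by
    rw [(hasDerivAt_energyExcess hsin.ne' hcos.ne).deriv]
    exact mul_pos_of_neg_of_neg (div_neg_of_pos_of_neg (by positivity)
      (mul_neg_of_pos_of_neg hsin hcos)) hconj
  have hsign := eventually_nhdsWithin_sign_eq_of_deriv_pos hderiv
    (energyExcess_self hsin.ne' hcos.ne)
  obtain ⟨τ, hτ, hmem⟩ :=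
    ((hsign.filter_mono nhdsWithin_le_nhds).and (Ioo_mem_nhdsLT hT)).exists
  refine ⟨τ, hmem, ?_⟩
  rwa [sign_neg (sub_neg.2 hmem.2), sign_eq_neg_one_iff] at hτ

theorem add_mul_sin_le_tan_mul {c ψ : ℝ} (hc : 0 ≤ c) (hψ0 : 0 ≤ ψ) (hψ : ψ < π / 2) :
    ψ + c * sin ψ ≤ tan ψ * (1 + c) := by
  have htan := le_tan hψ0 hψ
  calc ψ + c * sin ψ ≤ tan ψ + c * tan ψ := by gcongr; exact (sin_le hψ0).trans htan
    _ = tan ψ * (1 + c) := by ring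

variable {n p : ℕ} (F : AdaptedFrame n p 2)

theorem AdaptedFrame.stiefelDist_greatCircle_lt_of_sq_lt {τ ψ k : ℝ} (hτ : 0 < τ)
    (hsin : sin τ ≠ 0) (hu : cos τ = cos T * cos ψ) (hv : k * sin τ = -(cos T * sin ψ))
    (hβ : 0 ≤ β) (hT : 0 < T) (h : (τ * (sin T / sin τ)) ^ 2 + β * (ψ + k * τ) ^ 2 < T ^ 2) :
    stiefelDist β (F.greatCircle 0) (F.greatCircle T) < ENNReal.ofReal (√2 * T) := by
  refine (F.stiefelDist_greatCircle_le hτ hsin hu hv hβ).trans_lt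
    ((ENNReal.ofReal_lt_ofReal_iff (by positivity)).2 ?_)
  rw [sqrt_lt' (by positivity), mul_pow √2, sq_sqrt zero_le_two]
  exact mul_lt_mul_of_pos_left h two_pos

theorem AdaptedFrame.stiefelDist_greatCircle_lt_of_energyExcess_neg {τ : ℝ} (hβ : 0 ≤ β)
    (hτ : π / 2 < τ) (hτT : τ < T) (hTπ : T < π) (hexc : energyExcess β T τ < 0) :
    stiefelDist β (F.greatCircle 0) (F.greatCircle T) < ENNReal.ofReal (√2 * T) := by
  have hτ0 : 0 < τ := pi_div_two_pos.trans hτ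
  have hsin : 0 < sin τ := sin_pos_of_pos_of_lt_pi hτ0 (hτT.trans hTπ)
  have hcosτ : cos τ < 0 := cos_neg_of_pi_div_two_lt_of_lt hτ (by linarith [pi_pos])
  have hcos : cos T < cos τ := cos_lt_cos_of_nonneg_of_le_pi hτ0.le hTπ.le hτT
  have hcosT := hcos.trans hcosτ
  set ψ := arccos (cos τ / cos T)
  have hratio : 0 < cos τ / cos T := div_pos_of_neg_of_neg hcosτ hcosT
  have hcosψ : cos ψ = cos τ / cos T :=
    cos_arccos (by linarith) ((div_le_one_of_neg hcosT).2 hcos.le)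
  have hψ0 : 0 ≤ ψ := arccos_nonneg _
  have hsinψ : 0 ≤ sin ψ := sin_nonneg_of_nonneg_of_le_pi hψ0 (arccos_le_pi _)
  have hψ : ψ < π / 2 := arccos_lt_pi_div_two.2 hratio
  refine F.stiefelDist_greatCircle_lt_of_sq_lt (k := -(cos T * sin ψ) / sin τ) hτ0 hsin.ne'
    (by rw [hcosψ, mul_div_cancel₀ _ hcosT.ne]) (div_mul_cancel₀ _ hsin.ne') hβ (hτ0.trans hτT) ?_
  have htan : tan ψ ^ 2 = (cos T / cos τ) ^ 2 - 1 := by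
    have h := inv_one_add_tan_sq (hcosψ.trans_ne hratio.ne')
    rw [inv_eq_iff_eq_inv, hcosψ, ← inv_pow, inv_div] at h
    linarith
  have hc : 0 ≤ -cos T * (τ / sin τ) := mul_nonneg (neg_pos.2 hcosT).le (by positivity)
  have hfibre : (ψ + -(cos T * sin ψ) / sin τ * τ) ^ 2
      ≤ (tan ψ * (1 - cos T * (τ / sin τ))) ^ 2 := by
    rw [show ψ + -(cos T * sin ψ) / sin τ * τ = ψ + -cos T * (τ / sin τ) * sin ψ by ring,
      show 1 - cos T * (τ / sin τ) = 1 + -cos T * (τ / sin τ) by ring]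
    exact pow_le_pow_left₀ (by positivity) (add_mul_sin_le_tan_mul hc hψ0 hψ) 2
  rw [mul_pow, htan] at hfibre
  rw [energyExcess] at hexc
  rw [mul_div_left_comm τ]
  linarith [mul_le_mul_of_nonneg_left hfibre hβ]

theorem AdaptedFrame.stiefelDist_greatCircle_lt (hβ : 0 < β) (hβ1 : β < 1) (hT0 : 0 < T)
    (hTπ : T ≤ π) (hneg : conjugateFun ((1 - β) / β) T < 0) :
    stiefelDist β (F.greatCircle 0) (F.greatCircle T) < ENNReal.ofReal (√2 * T) := by
  have hκ : 0 < (1 - β) / β := div_pos (sub_pos.2 hβ1) hβ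
  have hT : π / 2 < T := not_le.1 fun h =>
    (conjugateFun_pos_of_le_pi_div_two (by linarith) hT0 h).not_gt hneg
  rcases hTπ.eq_or_lt with rfl | hTπ
  · -- half of the Hopf fibre
    refine F.stiefelDist_greatCircle_lt_of_sq_lt (τ := π / 2) (ψ := π / 2) (k := 1) pi_div_two_pos
      (by simp) (by simp) (by simp) hβ.le pi_pos ?_
    rw [sin_pi, zero_div, mul_zero, zero_pow two_ne_zero, zero_add, one_mul, add_halves]
    exact mul_lt_of_lt_one_left (by positivity) hβ1
  · obtain ⟨τ, ⟨hτ, hτT⟩, hexc⟩ := exists_energyExcess_neg hβ hT hTπ hneg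
    exact F.stiefelDist_greatCircle_lt_of_energyExcess_neg hβ.le hτ hτT hTπ hexc

theorem injRadius_le_of_conjugateFun_eq_zero (hp : 2 ≤ p) (hpn : p + 2 ≤ n) (hβ : 0 < β) {r : ℝ}
    (hr : 0 < r) (h0 : conjugateFun ((1 - β) / β) r = 0) :
    injRadius n p β ≤ ENNReal.ofReal (r * √2) := by
  rcases lt_or_ge β 1 with hβ1 | hβ1
  · have hκ : 0 < (1 - β) / β := div_pos (sub_pos.2 hβ1) hβ
    obtain ⟨F⟩ := nonempty_adaptedFrame hp hpn
    rw [mul_comm]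
    exact injRadius_le_of_periodic (F.isGeodesic_greatCircle β) (by positivity) pi_pos
      (F.metric_greatCircle β) F.greatCircle_periodic fun T hT =>
        F.stiefelDist_greatCircle_lt hβ hβ1 (hr.trans hT.1) hT.2
          (conjugateFun_neg hκ hr h0 hT.1 hT.2)
  · have hκ : -1 < (1 - β) / β := by rw [lt_div_iff₀ hβ]; linarith
    have hπr := pi_le_of_conjugateFun_eq_zero hκ
      (div_nonpos_of_nonpos_of_nonneg (by linarith) hβ.le) hr h0
    refine (injRadius_le_pi (by omega) (by omega)).trans (ENNReal.ofReal_le_ofReal ?_)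
    exact hπr.trans (le_mul_of_one_le_right hr.le (one_le_sqrt.2 one_le_two))

end Shortcut

end

end StiefelInj

theorem theorem7p1 (n p : ℕ) (hp : 2 ≤ p) (hpn : p + 2 ≤ n) (β : ℝ) (hβ : 0 < β) :
    ∃ tr : ℝ, IsLeast {t : ℝ | 0 < t ∧ Real.sin t / t + (1 - β) / β * Real.cos t = 0} tr ∧
      StiefelInj.injRadius n p β ≤
        ENNReal.ofReal (min (min (Real.sqrt (2 * β) * Real.pi) Real.pi) (tr * Real.sqrt 2)) := by
  have hκ : -1 < (1 - β) / β := by rw [lt_div_iff₀ hβ]; linarith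
  obtain ⟨r, hr⟩ := StiefelInj.exists_isLeast_conjugateFun_zero hκ
  have hset : {t : ℝ | 0 < t ∧ Real.sin t / t + (1 - β) / β * Real.cos t = 0}
      = {t | 0 < t ∧ StiefelInj.conjugateFun ((1 - β) / β) t = 0} :=
    Set.ext fun t => and_congr_right fun ht => by rw [StiefelInj.conjugateFun_of_pos ht]
  refine ⟨r, hset ▸ hr, ?_⟩
  rw [ENNReal.ofReal_mono.map_min, ENNReal.ofReal_mono.map_min]
  exact le_min (le_min (StiefelInj.injRadius_le_sqrt_two_mul_pi hp hpn hβ)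
    (StiefelInj.injRadius_le_pi (by omega) (by omega)))
    (StiefelInj.injRadius_le_of_conjugateFun_eq_zero hp hpn hβ hr.1.1 hr.1.2)
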